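/- Call a Borel measure on $\mathbb R$ or on $\mathbb T=\mathbb R/\mathbb Z$ *nondegenerate* if it is locally finite and gives positive measure to every nonempty open set. All intervals are bounded and of the form $[x,y)$, $x<y$; intervals (arcs) of $\mathbb T$ are the projections of intervals of $\mathbb R$ of length at most $1$. A measure $\mu$ on $\mathbb R$ or on $\mathbb T$ is *doubling* if there is $C>0$ with $\mu(I_1)\le C\,\mu(I_2)$ and $\mu(I_2)\le C\,\mu(I_1)$ for all adjacent intervals $I_1=[x,x+h)$, $I_2=[x+h,x+2h)$ of equal length $h>0$ (with $2h\le 1$ in the case of $\mathbb T$). It is *doubling on $[0,1)$* if such a $C$ exists for the pairs with $0\le x$ and $x+2h\le 1$ (on $\mathbb T$: for the projections of such pairs, that is, for pairs of arcs whose union does not cross the point $0\equiv1$). For an integer $n\ge 2$, the *$n$-adic intervals* of $\mathbb R$ are the intervals $\left[\frac{k-1}{n^m},\frac{k}{n^m}\right)$ with $m,k\in\mathbb Z$; those of $\mathbb T$ are the projections of the ones with $m\ge 0$. The *children* of such an interval are the $n$ intervals $\left[\frac{k-1}{n^m}+\frac{j-1}{n^{m+1}},\frac{k-1}{n^m}+\frac{j}{n^{m+1}}\right)$,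 $1\le j\le n$. The measure $\mu$ is *$n$-adic doubling* if there is $C(n)>0$ with $\mu(J_1)\le C(n)\,\mu(J_2)$ whenever $J_1,J_2$ are children of a common $n$-adic interval. **Theorem.** On $\mathbb R$, and likewise on $\mathbb T$, there is an infinite family $(\mu_i)_{i\in\mathbb N}$ of nondegenerate measures, no two of which are multiples of one another, such that every $\mu_i$ is $n$-adic doubling for every $n\ge2$ but is not doubling; in fact $\mu_i$ is not even doubling on $[0,1)$. -/

import Mathlib

open MeasureTheory Set
open scoped NNReal

/-- The `j`-th child (`1 ≤ j ≤ n`) of the `n`-adic interval `[(k-1)/n^m, k/n^m)`. -/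
def nadicChild (n : ℕ) (m k : ℤ) (j : ℕ) : Set ℝ :=
  Ico (((k : ℝ) - 1) / (n : ℝ) ^ m + ((j : ℝ) - 1) / (n : ℝ) ^ (m + 1))
    (((k : ℝ) - 1) / (n : ℝ) ^ m + (j : ℝ) / (n : ℝ) ^ (m + 1))

/-- The doubling inequality on `ℝ` for all pairs of adjacent half-open intervals of equal length
whose union lies in `D`. -/
def IsDoublingOn (D : Set ℝ) (μ : Measure ℝ) : Prop :=
  ∃ C : ℝ≥0, 0 < C ∧ ∀ x h : ℝ, 0 < h → Ico x (x + 2 * h) ⊆ D →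
    μ (Ico x (x + h)) ≤ C * μ (Ico (x + h) (x + 2 * h)) ∧
    μ (Ico (x + h) (x + 2 * h)) ≤ C * μ (Ico x (x + h))

/-- A doubling measure on `ℝ`. -/
def IsDoubling (μ : Measure ℝ) : Prop := IsDoublingOn univ μ

/-- An `n`-adic doubling measure on `ℝ`: any two children of any `n`-adic interval, of any scale
`n ^ (-m)` with `m ∈ ℤ`, have comparable measure. -/
def IsNadicDoubling (n : ℕ) (μ : Measure ℝ) : Prop :=
  ∃ C : ℝ≥0, 0 < C ∧ ∀ m k : ℤ, ∀ i ∈ Finset.Icc 1 n, ∀ j ∈ Finset.Icc 1 n,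
    μ (nadicChild n m k i) ≤ C * μ (nadicChild n m k j)

/-- The projection to the torus `ℝ / ℤ` of a subset of `ℝ`. -/
def toTorus (I : Set ℝ) : Set UnitAddCircle := (fun x : ℝ => (x : UnitAddCircle)) '' I

/-- The doubling inequality on the torus for all pairs of adjacent arcs of equal length (so of
length at most `1/2`) whose union is the projection of an interval that lies in `D`. -/
def IsTorusDoublingOn (D : Set ℝ) (μ : Measure UnitAddCircle) : Prop :=
  ∃ C : ℝ≥0, 0 < C ∧ ∀ x h : ℝ, 0 < h → 2 * h ≤ 1 → Ico x (x + 2 * h) ⊆ D →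
    μ (toTorus (Ico x (x + h))) ≤ C * μ (toTorus (Ico (x + h) (x + 2 * h))) ∧
    μ (toTorus (Ico (x + h) (x + 2 * h))) ≤ C * μ (toTorus (Ico x (x + h)))

/-- A doubling measure on the torus; arcs across the point `0 ≡ 1` are included. -/
def IsTorusDoubling (μ : Measure UnitAddCircle) : Prop := IsTorusDoublingOn univ μ

/-- An `n`-adic doubling measure on the torus, where the `n`-adic intervals are those of length
`n ^ (-m)` with `m ≥ 0`. -/
def IsTorusNadicDoubling (n : ℕ) (μ : Measure UnitAddCircle) : Prop :=
  ∃ C : ℝ≥0, 0 < C ∧ ∀ (m : ℕ) (k : ℤ), ∀ i ∈ Finset.Icc 1 n, ∀ j ∈ Finset.Icc 1 n,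
    μ (toTorus (nadicChild n m k i)) ≤ C * μ (toTorus (nadicChild n m k j))

/-! The measures have a density that is `1` except for dips accumulating at `0`. The dip at `p` has
depth `v` and recovers over length about `v * r` on the left but `r` on the right, so the intervals
of length `v * r` adjacent to `p` have masses with ratio of order `v`. Since `v = 1 / (k + 2)` tends
to `0` along the places, doubling fails.

An `n`-adic interval does not see this asymmetry. Dirichlet approximation (`exists_near_nadic`) puts
`p k`, for all `n ≤ k + 2` at once, within a small multiple of `r k` of an `n`-adic point of scale
at least `r k`. Shorter `n`-adic intervals lie essentially on one side of `p`, where the dip is a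
truncated linear function; longer ones see the dip only as a bounded loss (`isSpread_dip`). For
fixed `n` the finitely many early dips cost a constant factor. Non-proportional measures come from
changing the density on `[1/2, 1)`, and restriction to `[0, 1)` transfers everything to the torus.
-/

/-! ### Diophantine choice of the places -/

/-- Simultaneous approximation of zero: some positive multiple `d ≤ Q ^ K` of the vector `x`
is within `1 / Q` of an integer vector. -/
theorem exists_mul_near_int {K Q : ℕ} (hQ : 0 < Q) (x : Fin K → ℝ) :
    ∃ d : ℕ, 0 < d ∧ d ≤ Q ^ K ∧ ∀ i, ∃ z : ℤ, |d * x i - z| ≤ 1 / Q := by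
  have hQ' : (0 : ℝ) < Q := by exact_mod_cast hQ
  have hlt : ∀ y : ℝ, ⌊Int.fract y * Q⌋₊ < Q := fun y => by
    rw [Nat.floor_lt (by positivity)]
    nlinarith [Int.fract_lt_one y]
  -- Pigeonhole: `Q ^ K + 1` multiples of `x` fall into `Q ^ K` boxes of side `1 / Q` modulo `1`.
  let F : Fin (Q ^ K + 1) → (Fin K → Fin Q) := fun j i => ⟨⌊Int.fract ((j : ℕ) * x i) * Q⌋₊, hlt _⟩
  have hcard : Fintype.card (Fin K → Fin Q) < Fintype.card (Fin (Q ^ K + 1)) := by simp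
  obtain ⟨s, t, hst, hF⟩ := Fintype.exists_ne_map_eq_of_card_lt F hcard
  wlog h : s < t generalizing s t
  · exact this t s hst.symm hF.symm (lt_of_le_of_ne (not_lt.1 h) hst.symm)
  have h' : (s : ℕ) < t := h
  refine ⟨t - s, by omega, by omega, fun i => ⟨⌊((t : ℕ) : ℝ) * x i⌋ - ⌊((s : ℕ) : ℝ) * x i⌋, ?_⟩⟩
  have hi : ⌊Int.fract ((s : ℕ) * x i) * Q⌋₊ = ⌊Int.fract ((t : ℕ) * x i) * Q⌋₊ :=
    congrArg Fin.val (congrFun hF i)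
  have hs := Nat.floor_le (show 0 ≤ Int.fract ((s : ℕ) * x i) * Q by positivity)
  have ht := Nat.floor_le (show 0 ≤ Int.fract ((t : ℕ) * x i) * Q by positivity)
  have hs2 := Nat.lt_floor_add_one (Int.fract ((s : ℕ) * x i) * Q)
  have ht2 := Nat.lt_floor_add_one (Int.fract ((t : ℕ) * x i) * Q)
  rw [← hi] at ht ht2
  have e : (((t : ℕ) - (s : ℕ) : ℕ) : ℝ) * x i
      - ((⌊((t : ℕ) : ℝ) * x i⌋ - ⌊((s : ℕ) : ℝ) * x i⌋ : ℤ) : ℝ)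
      = Int.fract ((t : ℕ) * x i) - Int.fract ((s : ℕ) * x i) := by
    rw [Nat.cast_sub h'.le]
    push_cast
    have h1 := Int.fract_add_floor (((t : ℕ) : ℝ) * x i)
    have h2 := Int.fract_add_floor (((s : ℕ) : ℝ) * x i)
    linarith
  rw [e, abs_le, ← neg_div, div_le_iff₀ hQ', le_div_iff₀ hQ']
  constructor <;> nlinarith

/-- Arbitrarily close to `0` there is a point `p` that is, up to a small multiple of a scale `r`
much smaller than `p`, an `n`-adic point of scale at least `r` for all `2 ≤ n ≤ K`. -/
theorem exists_near_nadic (K : ℕ) {T δ η : ℝ} (hT : 0 < T) (hδ : 0 < δ) (hη : 0 < η) :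
    ∃ p r : ℝ, 0 < r ∧ T * r ≤ p ∧ p ≤ δ ∧ ∀ n : ℕ, 2 ≤ n → n ≤ K →
      ∃ (m : ℕ) (a : ℤ), r ≤ 1 / (n : ℝ) ^ m ∧ |p - a / (n : ℝ) ^ m| ≤ η * r := by
  obtain ⟨Q, hQ⟩ := exists_nat_gt ((K + 1) / η)
  have hQ0 : (0 : ℝ) < Q := lt_of_le_of_lt (by positivity) hQ
  have hQ0' : 0 < Q := by exact_mod_cast hQ0
  obtain ⟨N, hN⟩ := exists_nat_gt ((Q : ℝ) ^ (K + 1) * T / δ)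
  have hN0 : (0 : ℝ) < N := lt_of_le_of_lt (by positivity) hN
  have hN0' : 0 < N := by exact_mod_cast hN0
  -- With `P` the largest power of `n` up to `N`, the point `p = d * T / N` is near `z / P` as soon
  -- as `d * (T * P / N)` is near `z`. The coordinates `0` and `1` are not used.
  obtain ⟨d, hd, hdQ, hz⟩ := exists_mul_near_int (K := K + 1) hQ0'
    (fun i => T * ((i : ℕ) : ℝ) ^ Nat.log i N / N)
  have hd1 : (1 : ℝ) ≤ d := by exact_mod_cast hd
  have hdQ' : (d : ℝ) ≤ (Q : ℝ) ^ (K + 1) := by exact_mod_cast hdQ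
  refine ⟨d * T / N, 1 / N, by positivity, ?_, ?_, fun n hn hnK => ?_⟩
  · rw [mul_one_div]
    gcongr
    nlinarith
  · rw [div_lt_iff₀ hδ] at hN
    rw [div_le_iff₀ hN0]
    nlinarith
  obtain ⟨z, hz⟩ := hz ⟨n, by omega⟩
  have hn0 : (0 : ℝ) < n := by exact_mod_cast (by omega : 0 < n)
  set P : ℝ := (n : ℝ) ^ Nat.log n N with hP
  have hP0 : 0 < P := by positivity
  have h1 : P ≤ N := by
    rw [hP]
    exact_mod_cast Nat.pow_log_le_self n hN0'.ne'
  have h2 : (N : ℝ) < P * n := by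
    have := Nat.lt_pow_succ_log_self (by omega : 1 < n) N
    rw [pow_succ] at this
    rw [hP]
    exact_mod_cast this
  refine ⟨Nat.log n N, z, by gcongr, ?_⟩
  have e : (d : ℝ) * T / N - z / P = (d * (T * P / N) - z) / P := by field_simp
  rw [e, abs_div, abs_of_pos hP0, div_le_iff₀ hP0]
  -- The error `1 / (Q * P)` is below `n / (Q * N)`, since `N < P * n`; the choice of `Q` absorbs `n
  -- ≤ K`.
  refine hz.trans ?_
  rw [div_lt_iff₀ hη] at hQ
  have hnK' : (n : ℝ) ≤ K := by exact_mod_cast hnK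
  rw [mul_one_div, div_mul_eq_mul_div, div_le_div_iff₀ hQ0 hN0]
  have h3 : P * n ≤ P * (Q * η) := by
    gcongr
    linarith
  linarith

/-- A sequence of places accumulating at `0`: centres `p k` and radii `r k`. -/
theorem exists_places :
    ∃ p r : ℕ → ℝ, (∀ k, 0 < r k) ∧ (∀ k : ℕ, 40 * ((k : ℝ) + 2) * r k ≤ p k) ∧ (∀ k, p k ≤ 1 / 8) ∧
      (∀ k, p (k + 1) ≤ p k / 8) ∧ ∀ k n : ℕ, 2 ≤ n → n ≤ k + 2 → ∃ (m : ℕ) (a : ℤ),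
        r k ≤ 1 / (n : ℝ) ^ m ∧
        |p k - a / (n : ℝ) ^ m| ≤ ((k : ℝ) + 2)⁻¹ ^ 2 / 2 * r k := by
  choose! P R hR hT hδ hn using fun (k : ℕ) (δ : ℝ) (hδ : 0 < δ) =>
    exists_near_nadic (k + 2) (T := 40 * ((k : ℝ) + 2)) (δ := δ)
      (η := ((k : ℝ) + 2)⁻¹ ^ 2 / 2) (by positivity) hδ (by positivity)
  -- `b k` is the upper bound imposed on the `k`-th centre: an eighth of the previous one.
  let b : ℕ → ℝ := fun k => Nat.rec (motive := fun _ => ℝ) (1 / 8) (fun k δ => P k δ / 8) k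
  have hbs : ∀ k, b (k + 1) = P k (b k) / 8 := fun k => rfl
  have hb : ∀ k, 0 < b k := fun k => by
    induction k with
    | zero => exact (by norm_num : (0 : ℝ) < 1 / 8)
    | succ k ih =>
      rw [hbs]
      have := hT k _ ih
      have hRk := hR k _ ih
      have : 0 < 40 * ((k : ℝ) + 2) * R k (b k) := by positivity
      linarith
  have hb' : ∀ k, b k ≤ 1 / 8 := fun k => by
    induction k with
    | zero => exact le_rfl
    | succ k ih =>
      rw [hbs]
      linarith [hδ k _ (hb k)]
  exact ⟨fun k => P k (b k), fun k => R k (b k), fun k => hR k _ (hb k), fun k => hT k _ (hb k),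
    fun k => (hδ k _ (hb k)).trans (hb' k),
    fun k => (hδ (k + 1) _ (hb (k + 1))).trans (hbs k).le, fun k n h2 hk => hn k _ (hb k) n h2 hk⟩

/-! ### A single asymmetric dip -/

/-- The weight with a dip at `p` that is `v⁻¹` times narrower on the left of `p` than on the
right. -/
noncomputable def dip (p r v x : ℝ) : ℝ :=
  if x < p then min 1 (v + (p - x) / (v * r)) else min 1 (v + (x - p) / r)

section dip

variable {p r v x : ℝ}

theorem measurable_dip : Measurable (dip p r v) := by
  unfold dip
  exact Measurable.ite measurableSet_Iio (by fun_prop) (by fun_prop)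

theorem dip_le_one : dip p r v x ≤ 1 := by
  unfold dip
  split_ifs <;> exact min_le_left _ _

/-- On the other side of `p` the right-branch expression is at most `v`, so it bounds the dip from
below everywhere. -/
theorem le_dip_right (hr : 0 < r) (hv : 0 < v) : min 1 (v + (x - p) / r) ≤ dip p r v x := by
  unfold dip
  split_ifs with h
  · refine min_le_min le_rfl ?_
    have : (x - p) / r ≤ 0 := div_nonpos_of_nonpos_of_nonneg (by linarith) hr.le
    have : 0 ≤ (p - x) / (v * r) := div_nonneg (by linarith) (by positivity)
    linarith
  · exact le_rfl

theorem le_dip_left (hr : 0 < r) (hv : 0 < v) :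
    min 1 (v + (p - x) / (v * r)) ≤ dip p r v x := by
  unfold dip
  split_ifs with h
  · exact le_rfl
  · refine min_le_min le_rfl ?_
    have : (p - x) / (v * r) ≤ 0 := div_nonpos_of_nonpos_of_nonneg (by linarith) (by positivity)
    have : 0 ≤ (x - p) / r := div_nonneg (by linarith) hr.le
    linarith

theorem le_dip (hr : 0 < r) (hv : 0 < v) (hv1 : v ≤ 1) : v ≤ dip p r v x := by
  rcases le_total x p with h | h
  · refine le_trans (le_min hv1 ?_) (le_dip_left hr hv)
    have : 0 ≤ (p - x) / (v * r) := div_nonneg (by linarith) (by positivity)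
    linarith
  · refine le_trans (le_min hv1 ?_) (le_dip_right hr hv)
    have : 0 ≤ (x - p) / r := div_nonneg (by linarith) hr.le
    linarith

theorem abs_le_dip (hr : 0 < r) (hv : 0 < v) (hv1 : v ≤ 1) :
    min 1 (|x - p| / r) ≤ dip p r v x := by
  rcases le_total x p with h | h
  · refine le_trans (min_le_min le_rfl ?_) (le_dip_left hr hv)
    rw [abs_sub_comm, abs_of_nonneg (by linarith)]
    have : (p - x) / r ≤ (p - x) / (v * r) :=
      div_le_div_of_nonneg_left (by linarith) (by positivity) (by nlinarith)
    linarith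
  · refine le_trans (min_le_min le_rfl ?_) (le_dip_right hr hv)
    rw [abs_of_nonneg (by linarith)]
    linarith

theorem dip_eq_one (hr : 0 < r) (hv : 0 < v) (hv1 : v ≤ 1) (hx : r ≤ |x - p|) :
    dip p r v x = 1 :=
  le_antisymm dip_le_one (le_trans (le_min le_rfl ((one_le_div hr).2 hx)) (abs_le_dip hr hv hv1))

/-- Just left of `p` the dip lies below twice its right branch. -/
theorem dip_le_of_sub_le {b : ℝ} (hr : 0 < r) (hv : 0 < v) (hv1 : v ≤ 1)
    (h : p - v ^ 2 / 2 * r ≤ x) (hxb : x ≤ b) (hpb : p ≤ b) :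
    dip p r v x ≤ 2 * min 1 (v + (b - p) / r) := by
  have h0 : 0 ≤ (b - p) / r := div_nonneg (by linarith) hr.le
  have hm : v ≤ min 1 (v + (b - p) / r) := le_min hv1 (by linarith)
  unfold dip
  split_ifs with hx
  · refine (min_le_right _ _).trans ?_
    -- The tolerance `v ^ 2 / 2 * r` is half of `v * (v * r)`: even on the steep side the dip cannot
    -- rise above `2 * v` within it.
    have : (p - x) / (v * r) ≤ v := by
      rw [div_le_iff₀ (by positivity)]
      nlinarith [mul_pos (mul_pos hv hv) hr]
    linarith
  · have : min 1 (v + (x - p) / r) ≤ min 1 (v + (b - p) / r) := by gcongr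
    linarith

/-- Just right of `p` the dip lies below twice its left branch. -/
theorem dip_le_of_le_add {a : ℝ} (hr : 0 < r) (hv : 0 < v) (hv1 : v ≤ 1)
    (h : x ≤ p + v ^ 2 / 2 * r) (hax : a ≤ x) (hap : a ≤ p) :
    dip p r v x ≤ 2 * min 1 (v + (p - a) / (v * r)) := by
  have h0 : 0 ≤ (p - a) / (v * r) := div_nonneg (by linarith) (by positivity)
  have hm : v ≤ min 1 (v + (p - a) / (v * r)) := le_min hv1 (by linarith)
  unfold dip
  split_ifs with hx
  · have : min 1 (v + (p - x) / (v * r)) ≤ min 1 (v + (p - a) / (v * r)) := by gcongr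
    linarith
  · refine (min_le_right _ _).trans ?_
    have : (x - p) / r ≤ v := by
      rw [div_le_iff₀ hr]
      nlinarith [mul_pos hv hr, mul_le_mul_of_nonneg_right hv1 (mul_pos hv hr).le]
    linarith

end dip

/-! ### Spread weights -/

/-- On `[a, a + l)` the weight `w` is, up to a factor depending on `n`, at its maximum on a quarter
of every subinterval of length `l / n`. -/
def IsSpread (w : ℝ → ℝ) (n : ℕ) (a l : ℝ) : Prop :=
  ∃ M > 0, (∀ x ∈ Ico a (a + l), w x ≤ M) ∧ ∀ c, a ≤ c → c + l / n ≤ a + l →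
    ∃ S ⊆ Ico c (c + l / n), MeasurableSet S ∧ ENNReal.ofReal (l / (4 * n)) ≤ volume S ∧
      ∀ x ∈ S, M / (8 * n) ≤ w x

theorem IsSpread.congr {w w' : ℝ → ℝ} {n : ℕ} {a l : ℝ} (h : IsSpread w n a l)
    (hw : ∀ x ∈ Ico a (a + l), w x = w' x) : IsSpread w' n a l := by
  obtain ⟨M, hM, h1, h2⟩ := h
  refine ⟨M, hM, fun x hx => hw x hx ▸ h1 x hx, fun c hac hc => ?_⟩
  obtain ⟨S, hS, hS1, hS2, hS3⟩ := h2 c hac hc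
  refine ⟨S, hS, hS1, hS2, fun x hx => hw x ?_ ▸ hS3 x hx⟩
  exact Ico_subset_Ico hac hc (hS hx)

theorem isSpread_one {n : ℕ} (hn : 1 ≤ n) {a l : ℝ} (hl : 0 < l) :
    IsSpread (fun _ => 1) n a l := by
  have hn' : (1 : ℝ) ≤ n := by exact_mod_cast hn
  refine ⟨1, one_pos, fun _ _ => le_rfl, fun c _ _ =>
    ⟨_, subset_rfl, measurableSet_Ico, ?_, fun x _ => ?_⟩⟩
  · rw [Real.volume_Ico]
    apply ENNReal.ofReal_le_ofReal
    rw [add_sub_cancel_left]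
    gcongr
    linarith
  · rw [div_le_one (by linarith)]
    linarith

/-- Removing an interval of length at most half of its own from an interval. -/
theorem le_volume_diff {c s u t : ℝ} (hs : 0 ≤ s) (ht : t ≤ s / 2) :
    ENNReal.ofReal (s / 2) ≤ volume (Ico c (c + s) \ Ioo u (u + t)) := by
  refine le_trans ?_ (le_measure_sdiff (μ := volume))
  rw [Real.volume_Ico, Real.volume_Ioo, add_sub_cancel_left, add_sub_cancel_left]
  refine ENNReal.le_sub_of_add_le_right ENNReal.ofReal_ne_top ?_
  rcases le_total 0 t with h | h
  · rw [← ENNReal.ofReal_add (by linarith) h]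
    exact ENNReal.ofReal_le_ofReal (by linarith)
  · rw [ENNReal.ofReal_of_nonpos h, add_zero]
    exact ENNReal.ofReal_le_ofReal (by linarith)

theorem min_one_div_le {n : ℝ} (hn : 1 ≤ n) {y z : ℝ} (h : y / n ≤ z) :
    min 1 y / n ≤ min 1 z := by
  refine le_min ?_ ?_
  · rw [div_le_one (by linarith)]
    exact (min_le_left _ _).trans hn
  · refine le_trans ?_ h
    gcongr
    exact min_le_right _ _

/-- A long interval loses only a short neighbourhood of `p`. A short one is, up to the tolerance, on
one side of `p`, and a monotone truncated linear function is comparable to its maximum on the half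
of each subinterval farther from `p`. -/
theorem isSpread_dip {n : ℕ} (hn : 1 ≤ n) {p r v a l : ℝ} (hr : 0 < r) (hv : 0 < v) (hv1 : v ≤ 1)
    (hl : 0 < l) (h : r ≤ l ∨ p - v ^ 2 / 2 * r ≤ a ∨ a + l ≤ p + v ^ 2 / 2 * r) :
    IsSpread (dip p r v) n a l := by
  have hn' : (1 : ℝ) ≤ n := by exact_mod_cast hn
  have hn0 : (0 : ℝ) < n := by linarith
  have hvr : 0 < v * r := by positivity
  have hvv : v ^ 2 / 2 * r ≤ v / 2 * r := by
    gcongr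
    nlinarith
  have hsn : l / (4 * n) = l / (2 * n) / 2 := by field_simp; norm_num
  have hsn2 : l / n = l / (2 * n) + l / (2 * n) := by field_simp; norm_num
  have hs0 : 0 < l / (2 * n) := by positivity
  have hvol : ∀ c : ℝ, ENNReal.ofReal (l / (4 * n)) ≤ volume (Ico c (c + l / (2 * n))) := fun c => by
    rw [Real.volume_Ico]
    apply ENNReal.ofReal_le_ofReal
    linarith
  have hsl : l / (2 * n) ≤ l / 2 := by
    gcongr
    linarith
  -- An interval entirely beyond `p` belongs to the other branch, so each bound is needed only where
  -- its branch dominates.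
  have h' : r ≤ l ∨ (p - v ^ 2 / 2 * r ≤ a ∧ p ≤ a + l) ∨ (a + l ≤ p + v ^ 2 / 2 * r ∧ a ≤ p) := by
    have he : 0 < v ^ 2 / 2 * r := by positivity
    rcases h with h | h | h
    · exact Or.inl h
    · rcases le_total p (a + l) with hp | hp
      · exact Or.inr (Or.inl ⟨h, hp⟩)
      · exact Or.inr (Or.inr ⟨by linarith, by linarith⟩)
    · rcases le_total a p with hp | hp
      · exact Or.inr (Or.inr ⟨h, hp⟩)
      · exact Or.inr (Or.inl ⟨by linarith, by linarith⟩)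
  have key : ∀ D e : ℝ, 0 ≤ e + D → (e + (D + l)) / (4 * n) ≤ e + (D + l / (2 * n)) := fun D e h0 => by
    have h1 : (e + (D + l)) / (4 * n) = (e + D) / (4 * n) + l / (4 * n) := by ring
    have h2 : (e + D) / (4 * n) ≤ e + D := div_le_self h0 (by linarith)
    linarith
  rcases h' with h | ⟨h, hp⟩ | ⟨h, hp⟩
  · refine ⟨1, one_pos, fun _ _ => dip_le_one, fun c _ _ =>
      ⟨Ico c (c + l / n) \ Ioo (p - l / (8 * n)) (p - l / (8 * n) + l / (4 * n)), sdiff_subset,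
        measurableSet_Ico.diff measurableSet_Ioo, ?_, fun x hx => ?_⟩⟩
    · refine le_trans (ENNReal.ofReal_le_ofReal ?_) (le_volume_diff (by positivity) ?_) <;> linarith
    · have h8 : l / (4 * n) = l / (8 * n) + l / (8 * n) := by field_simp; norm_num
      refine le_trans (le_min ?_ ?_) (abs_le_dip hr hv hv1)
      · rw [div_le_one (by positivity)]
        linarith
      · have hx2 : l / (8 * n) ≤ |x - p| := by
          by_contra hcon
          rw [not_le, abs_lt] at hcon
          exact hx.2 ⟨by linarith [hcon.1], by linarith [hcon.2]⟩
        rw [le_div_iff₀ hr]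
        refine le_trans ?_ hx2
        rw [div_mul_eq_mul_div, one_mul]
        gcongr
  · refine ⟨2 * min 1 (v + (a + l - p) / r), ?_, fun x hx =>
      dip_le_of_sub_le hr hv hv1 (h.trans hx.1) hx.2.le hp, fun c hac hc =>
      ⟨Ico (c + l / (2 * n)) (c + l / (2 * n) + l / (2 * n)), ?_, measurableSet_Ico, hvol _,
        fun x hx => ?_⟩⟩
    · have : 0 ≤ (a + l - p) / r := div_nonneg (by linarith) hr.le
      have : 0 < min 1 (v + (a + l - p) / r) := lt_min one_pos (by linarith)
      linarith
    · exact Ico_subset_Ico (by linarith) (by linarith)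
    · refine le_trans ?_ (le_dip_right hr hv)
      rw [show 2 * min 1 (v + (a + l - p) / r) / (8 * n)
        = min 1 (v + (a + l - p) / r) / (4 * n) by ring]
      refine min_one_div_le (by linarith) ?_
      have h1 : v + (a + l - p) / r = (v * r + ((a - p) + l)) / r := by field_simp; ring
      have h2 : v + (x - p) / r = (v * r + (x - p)) / r := by field_simp
      rw [h1, h2, div_right_comm]
      gcongr
      refine (key _ _ (by nlinarith)).trans ?_
      linarith [hx.1]
  · refine ⟨2 * min 1 (v + (p - a) / (v * r)), ?_, fun x hx =>
      dip_le_of_le_add hr hv hv1 (hx.2.le.trans h) hx.1 hp, fun c hac hc =>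
      ⟨Ico c (c + l / (2 * n)), ?_, measurableSet_Ico, hvol _, fun x hx => ?_⟩⟩
    · have : 0 ≤ (p - a) / (v * r) := div_nonneg (by linarith) hvr.le
      have : 0 < min 1 (v + (p - a) / (v * r)) := lt_min one_pos (by linarith)
      linarith
    · exact Ico_subset_Ico le_rfl (by linarith)
    · refine le_trans ?_ (le_dip_left hr hv)
      rw [show 2 * min 1 (v + (p - a) / (v * r)) / (8 * n)
        = min 1 (v + (p - a) / (v * r)) / (4 * n) by ring]
      refine min_one_div_le (by linarith) ?_
      have h1 : v + (p - a) / (v * r) = (v * (v * r) + ((p - (a + l)) + l)) / (v * r) := by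
        field_simp; ring
      have h2 : v + (p - x) / (v * r) = (v * (v * r) + (p - x)) / (v * r) := by field_simp
      rw [h1, h2, div_right_comm]
      gcongr
      refine (key _ _ (by nlinarith)).trans ?_
      linarith [hx.2]
-- Infinitely many dips
/-- Centres `p k` and radii `r k` of places accumulating at `0`, such that `p k` is close to an
`n`-adic point of scale at least `r k` for all `2 ≤ n ≤ k + 2`. -/
structure IsPlaces (p r : ℕ → ℝ) : Prop where
  radius_pos : ∀ k, 0 < r k
  radius_le : ∀ k : ℕ, 40 * ((k : ℝ) + 2) * r k ≤ p k
  centre_le : ∀ k, p k ≤ 1 / 8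
  centre_succ_le : ∀ k, p (k + 1) ≤ p k / 8
  near_nadic : ∀ k n : ℕ, 2 ≤ n → n ≤ k + 2 → ∃ (m : ℕ) (a : ℤ), r k ≤ 1 / (n : ℝ) ^ m ∧
    |p k - a / (n : ℝ) ^ m| ≤ ((k : ℝ) + 2)⁻¹ ^ 2 / 2 * r k

/-- The dip at the place `k`. -/
noncomputable def dipAt (p r : ℕ → ℝ) (k : ℕ) (x : ℝ) : ℝ := dip (p k) (r k) ((k : ℝ) + 2)⁻¹ x

/-- The weight with dips at all places from the `N`-th on. -/
noncomputable def tailWeight (p r : ℕ → ℝ) (N : ℕ) (x : ℝ) : ℝ := ⨅ k, dipAt p r (k + N) x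

theorem inv_add_two_pos (k : ℕ) : (0 : ℝ) < ((k : ℝ) + 2)⁻¹ := by positivity

theorem inv_add_two_le (k : ℕ) : ((k : ℝ) + 2)⁻¹ ≤ 1 / 2 := by
  rw [one_div]
  gcongr
  linarith [k.cast_nonneg (α := ℝ)]

namespace IsPlaces

variable {p r : ℕ → ℝ} (h : IsPlaces p r)
include h

theorem radius_le_div (k : ℕ) : r k ≤ p k / 80 := by
  have := h.radius_le k
  have : 0 ≤ (k : ℝ) * r k := mul_nonneg k.cast_nonneg (h.radius_pos k).le
  linarith

theorem centre_pos (k : ℕ) : 0 < p k := by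
  linarith [h.radius_pos k, h.radius_le_div k]

theorem centre_le_of_lt {j k : ℕ} (hjk : j < k) : p k ≤ p j / 8 := by
  have hanti : Antitone p := antitone_nat_of_succ_le fun k => by
    linarith [h.centre_succ_le k, h.centre_pos k]
  exact (hanti hjk).trans (h.centre_succ_le j)

theorem dipAt_eq_one {k : ℕ} {x : ℝ} (hx : r k ≤ |x - p k|) : dipAt p r k x = 1 :=
  dip_eq_one (h.radius_pos k) (inv_add_two_pos k) (by linarith [inv_add_two_le k]) hx

theorem abs_lt_of_dipAt_lt {k : ℕ} {x : ℝ} (hx : dipAt p r k x < 1) : |x - p k| < r k := by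
  by_contra hcon
  exact hx.ne (h.dipAt_eq_one (not_lt.1 hcon))

theorem le_dipAt (k : ℕ) (x : ℝ) : ((k : ℝ) + 2)⁻¹ ≤ dipAt p r k x :=
  le_dip (h.radius_pos k) (inv_add_two_pos k) (by linarith [inv_add_two_le k])

omit h in
theorem dipAt_centre (k : ℕ) : dipAt p r k (p k) < 1 := by
  have := inv_add_two_le k
  simp only [dipAt, dip, lt_irrefl, if_false, sub_self, zero_div, add_zero]
  exact (min_le_right _ _).trans_lt (by linarith)

/-- Centres drop by a factor `8` and radii are at most `p / 80`, so `[a, 2 * a]` cannot meet two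
dips. -/
theorem not_lt_of_dipAt_lt {a x y : ℝ} {j k : ℕ} (hx : x ∈ Icc a (2 * a)) (hy : y ∈ Icc a (2 * a))
    (hjx : dipAt p r j x < 1) (hky : dipAt p r k y < 1) : ¬ j < k := fun hjk => by
  have h1 := (abs_lt.1 (h.abs_lt_of_dipAt_lt hjx)).1
  have h2 := (abs_lt.1 (h.abs_lt_of_dipAt_lt hky)).2
  linarith [h.centre_le_of_lt hjk, h.radius_le_div j, h.radius_le_div k, hx.2, hy.1,
    h.centre_pos j, h.centre_pos k]

theorem eq_of_dipAt_lt {a x y : ℝ} {j k : ℕ} (hx : x ∈ Icc a (2 * a)) (hy : y ∈ Icc a (2 * a))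
    (hjx : dipAt p r j x < 1) (hky : dipAt p r k y < 1) : j = k :=
  le_antisymm (not_lt.1 (h.not_lt_of_dipAt_lt hy hx hky hjx))
    (not_lt.1 (h.not_lt_of_dipAt_lt hx hy hjx hky))

theorem bddBelow_dipAt (N : ℕ) (x : ℝ) : BddBelow (range fun k => dipAt p r (k + N) x) :=
  ⟨0, by
    rintro _ ⟨k, rfl⟩
    exact (inv_add_two_pos _).le.trans (h.le_dipAt _ _)⟩

theorem tailWeight_le (N k : ℕ) (x : ℝ) : tailWeight p r N x ≤ dipAt p r (k + N) x :=
  ciInf_le (h.bddBelow_dipAt N x) k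

theorem tailWeight_le_one (N : ℕ) (x : ℝ) : tailWeight p r N x ≤ 1 :=
  (h.tailWeight_le N 0 x).trans dip_le_one

theorem tailWeight_eq {N k : ℕ} {x : ℝ} (hk : ∀ j, j ≠ k → dipAt p r (j + N) x = 1) :
    tailWeight p r N x = dipAt p r (k + N) x := by
  refine le_antisymm (h.tailWeight_le N k x) (le_ciInf fun j => ?_)
  by_cases hj : j = k
  · rw [hj]
  · rw [hk j hj]
    exact dip_le_one

theorem tailWeight_eq_dipAt {N k : ℕ} {a x y : ℝ} (hx : x ∈ Icc a (2 * a))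
    (hy : y ∈ Icc a (2 * a)) (hky : dipAt p r (k + N) y < 1) :
    tailWeight p r N x = dipAt p r (k + N) x := by
  refine h.tailWeight_eq fun j hj => ?_
  by_contra hcon
  have := h.eq_of_dipAt_lt hx hy (lt_of_le_of_ne dip_le_one hcon) hky
  omega

theorem exists_tailWeight_eq (N : ℕ) (a : ℝ) :
    ∃ k, ∀ x ∈ Icc a (2 * a), tailWeight p r N x = dipAt p r (k + N) x := by
  by_cases hex : ∃ k, ∃ y ∈ Icc a (2 * a), dipAt p r (k + N) y < 1
  · obtain ⟨k, y, hy, hky⟩ := hex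
    exact ⟨k, fun x hx => h.tailWeight_eq_dipAt hx hy hky⟩
  · push Not at hex
    exact ⟨0, fun x hx => h.tailWeight_eq fun j _ => le_antisymm dip_le_one (hex j x hx)⟩

theorem tailWeight_of_nonpos (N : ℕ) {x : ℝ} (hx : x ≤ 0) : tailWeight p r N x = 1 := by
  have h1 : ∀ k, dipAt p r k x = 1 := fun k => h.dipAt_eq_one <| by
    rw [abs_sub_comm, abs_of_nonneg] <;>
    linarith [h.radius_le_div k, h.radius_pos k]
  rw [h.tailWeight_eq (k := 0) fun j _ => h1 _, h1]

theorem tailWeight_of_ge (N : ℕ) {x : ℝ} (hx : 1 / 2 ≤ x) : tailWeight p r N x = 1 := by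
  have h1 : ∀ k, dipAt p r k x = 1 := fun k => h.dipAt_eq_one <| by
    rw [abs_of_nonneg] <;>
    linarith [h.radius_le_div k, h.radius_pos k, h.centre_le k]
  rw [h.tailWeight_eq (k := 0) fun j _ => h1 _, h1]

theorem tailWeight_pos (N : ℕ) (x : ℝ) : 0 < tailWeight p r N x := by
  rcases le_or_gt x 0 with hx | hx
  · rw [h.tailWeight_of_nonpos N hx]
    exact one_pos
  · obtain ⟨k, hk⟩ := h.exists_tailWeight_eq N x
    rw [hk x ⟨le_rfl, by linarith⟩]
    exact (inv_add_two_pos _).trans_le (h.le_dipAt _ _)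

theorem tailWeight_zero_le (N : ℕ) (x : ℝ) : tailWeight p r 0 x ≤ tailWeight p r N x :=
  le_ciInf fun k => h.tailWeight_le 0 (k + N) x

/-- The omitted dips have depth at least `1 / (N + 2)`. -/
theorem le_tailWeight_zero (N : ℕ) (x : ℝ) :
    ((N : ℝ) + 2)⁻¹ * tailWeight p r N x ≤ tailWeight p r 0 x := by
  refine le_ciInf fun k => ?_
  rw [add_zero]
  have h0 := h.tailWeight_pos N x
  have h1 := h.tailWeight_le_one N x
  have h2 := inv_add_two_le N
  have h3 := inv_add_two_pos N
  rcases le_total N k with hk | hk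
  · have := h.tailWeight_le N (k - N) x
    rw [Nat.sub_add_cancel hk] at this
    nlinarith
  · refine le_trans ?_ (h.le_dipAt k x)
    calc ((N : ℝ) + 2)⁻¹ * tailWeight p r N x ≤ ((N : ℝ) + 2)⁻¹ * 1 := by gcongr
      _ ≤ ((k : ℝ) + 2)⁻¹ := by
        rw [mul_one]
        gcongr

omit h in
theorem measurable_tailWeight (N : ℕ) : Measurable (tailWeight p r N) :=
  Measurable.iInf fun _ => measurable_dip

/-- Intervals starting at `0` meet infinitely many dips, but the right half of each subinterval
meets at most one. Either that dip is narrow and can be removed, or its centre is at least `5 * l`,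
far outside the interval. -/
theorem isSpread_zero {n N : ℕ} (hn : 2 ≤ n) (hN : n ≤ N + 2) {l : ℝ} (hl : 0 < l) :
    IsSpread (tailWeight p r N) n 0 l := by
  have hn' : (2 : ℝ) ≤ n := by exact_mod_cast hn
  have hn0 : (0 : ℝ) < n := by linarith
  have hN' : (n : ℝ) ≤ N + 2 := by exact_mod_cast hN
  refine ⟨1, one_pos, fun x _ => h.tailWeight_le_one N x, fun c hc0 hc => ?_⟩
  set s := l / n with hs
  have hsl : s * n = l := by rw [hs]; field_simp
  have hs0 : 0 < s := by positivity
  have hs4 : l / (4 * n) = s / 2 / 2 := by rw [hs]; field_simp; norm_num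
  obtain ⟨k, hk⟩ := h.exists_tailWeight_eq N (c + s / 2)
  have hsub : ∀ x ∈ Ico (c + s / 2) (c + s / 2 + s / 2), tailWeight p r N x = dipAt p r (k + N) x :=
    fun x hx => hk x ⟨hx.1, by linarith [hx.2]⟩
  have hM : (1 : ℝ) / (8 * n) ≤ 1 := by
    rw [div_le_one (by positivity)]
    linarith
  have hss : Ico (c + s / 2) (c + s / 2 + s / 2) ⊆ Ico c (c + s) :=
    Ico_subset_Ico (by linarith) (by linarith)
  by_cases hr : 2 * r (k + N) ≤ s / 2 / 2
  · refine ⟨Ico (c + s / 2) (c + s / 2 + s / 2) \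
      Ioo (p (k + N) - r (k + N)) (p (k + N) - r (k + N) + 2 * r (k + N)),
      sdiff_subset.trans hss, measurableSet_Ico.diff measurableSet_Ioo, ?_, fun x hx => ?_⟩
    · rw [hs4]
      exact le_volume_diff (by positivity) hr
    · rw [hsub x hx.1, h.dipAt_eq_one]
      · exact hM
      · by_contra hcon
        rw [not_le, abs_lt] at hcon
        exact hx.2 ⟨by linarith [hcon.1], by linarith [hcon.2]⟩
  · refine ⟨_, hss, measurableSet_Ico, ?_, fun x hx => ?_⟩
    · rw [Real.volume_Ico, hs4]
      exact ENNReal.ofReal_le_ofReal (by linarith)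
    · rw [hsub x hx, h.dipAt_eq_one]
      · exact hM
      · rw [not_le] at hr
        have h1 := h.radius_le (k + N)
        have h2 := h.radius_le_div (k + N)
        have h3 : 40 * (n : ℝ) * (s / 8) ≤ 40 * (((k + N : ℕ) : ℝ) + 2) * r (k + N) := by
          have : (0 : ℝ) ≤ k := k.cast_nonneg
          push_cast
          gcongr <;> linarith
        rw [abs_sub_comm, abs_of_nonneg] <;> linarith [hx.2, h.radius_pos (k + N)]

theorem isSpread_tailWeight {n N : ℕ} (hn : 2 ≤ n) (hN : n ≤ N + 2) (m K : ℤ) :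
    IsSpread (tailWeight p r N) n (K / (n : ℝ) ^ m) (1 / (n : ℝ) ^ m) := by
  have hn1 : (1 : ℝ) < n := by exact_mod_cast hn
  have hn0 : (0 : ℝ) < n := by linarith
  have hP : (0 : ℝ) < (n : ℝ) ^ m := by positivity
  have hl : (0 : ℝ) < 1 / (n : ℝ) ^ m := by positivity
  rcases lt_trichotomy K 0 with hK | rfl | hK
  · refine (isSpread_one (by omega) hl).congr fun x hx => (h.tailWeight_of_nonpos N ?_).symm
    have hK' : (K : ℝ) + 1 ≤ 0 := by exact_mod_cast hK
    have : (K : ℝ) / (n : ℝ) ^ m + 1 / (n : ℝ) ^ m ≤ 0 := by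
      rw [← add_div]
      exact div_nonpos_of_nonpos_of_nonneg hK' hP.le
    linarith [hx.2]
  · simpa using h.isSpread_zero hn hN hl
  · have hK' : (1 : ℝ) ≤ K := by exact_mod_cast hK
    have hla : 1 / (n : ℝ) ^ m ≤ K / (n : ℝ) ^ m := by gcongr
    obtain ⟨k, hk⟩ := h.exists_tailWeight_eq N (K / (n : ℝ) ^ m)
    refine IsSpread.congr ?_ fun x hx => (hk x ⟨hx.1, by linarith [hx.2]⟩).symm
    refine isSpread_dip (by omega) (h.radius_pos _) (inv_add_two_pos _)
      (by linarith [inv_add_two_le (k + N)]) hl ?_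
    refine or_iff_not_imp_left.2 fun hr => ?_
    obtain ⟨m', a, ha, hpa⟩ := h.near_nadic (k + N) n hn (by omega)
    rw [not_le] at hr
    have hlt : (n : ℝ) ^ (m' : ℤ) < (n : ℝ) ^ m := by
      rw [zpow_natCast]
      exact (one_div_lt_one_div hP (by positivity)).1 (hr.trans_le ha)
    -- The approximating point has a coarser scale, so it is a grid point of level `m` and cannot be
    -- interior to the interval.
    have hm : (m' : ℤ) < m := (zpow_lt_zpow_iff_right₀ hn1).1 hlt
    obtain ⟨d, rfl⟩ : ∃ d : ℕ, m = m' + d := ⟨(m - m').toNat, by omega⟩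
    have e : (a : ℝ) / (n : ℝ) ^ m' = ((a * (n : ℤ) ^ d : ℤ) : ℝ) / (n : ℝ) ^ ((m' : ℤ) + d) := by
      rw [zpow_add₀ hn0.ne', zpow_natCast, zpow_natCast]
      push_cast
      field_simp
    rw [e, abs_le] at hpa
    rcases le_or_gt (a * (n : ℤ) ^ d) K with hz | hz
    · left
      have : ((a * (n : ℤ) ^ d : ℤ) : ℝ) / (n : ℝ) ^ ((m' : ℤ) + d) ≤
        K / (n : ℝ) ^ ((m' : ℤ) + d) := by gcongr
      linarith [hpa.2]
    · right
      have hz' : (K : ℝ) + 1 ≤ ((a * (n : ℤ) ^ d : ℤ) : ℝ) := by exact_mod_cast hz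
      have : ((K : ℝ) + 1) / (n : ℝ) ^ ((m' : ℤ) + d) ≤
        ((a * (n : ℤ) ^ d : ℤ) : ℝ) / (n : ℝ) ^ ((m' : ℤ) + d) := by gcongr
      rw [add_div] at this
      linarith [hpa.1]

end IsPlaces

/-! ### The measures on the line -/

theorem withDensity_ofReal_le {f : ℝ → ℝ} {s : Set ℝ} {B : ℝ} (hs : MeasurableSet s)
    (h : ∀ x ∈ s, f x ≤ B) :
    volume.withDensity (fun x => ENNReal.ofReal (f x)) s ≤ ENNReal.ofReal B * volume s := by
  rw [withDensity_apply _ hs, ← setLIntegral_const]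
  exact setLIntegral_mono' hs fun x hx => ENNReal.ofReal_le_ofReal (h x hx)

theorem le_withDensity_ofReal {f : ℝ → ℝ} {s : Set ℝ} {B : ℝ} (hs : MeasurableSet s)
    (h : ∀ x ∈ s, B ≤ f x) :
    ENNReal.ofReal B * volume s ≤ volume.withDensity (fun x => ENNReal.ofReal (f x)) s := by
  rw [withDensity_apply _ hs, ← setLIntegral_const]
  exact setLIntegral_mono' hs fun x hx => ENNReal.ofReal_le_ofReal (h x hx)

/-- The factor `32 * n` combines the loss `8 * n` in height with the loss `4` in length. -/
theorem IsSpread.withDensity_le {w f : ℝ → ℝ} {n : ℕ} {a l α β : ℝ} (h : IsSpread w n a l)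
    (hn : 1 ≤ n) (hl : 0 < l) (hα : 0 < α) (hβ : 0 < β) (hwf : ∀ x, α * w x ≤ f x)
    (hfw : ∀ x, f x ≤ β * w x) {c c' : ℝ} (hc : a ≤ c) (hc2 : c + l / n ≤ a + l) (hc' : a ≤ c')
    (hc2' : c' + l / n ≤ a + l) :
    volume.withDensity (fun x => ENNReal.ofReal (f x)) (Ico c (c + l / n)) ≤
      ENNReal.ofReal (32 * n * (β / α)) *
        volume.withDensity (fun x => ENNReal.ofReal (f x)) (Ico c' (c' + l / n)) := by
  obtain ⟨M, hM, h1, h2⟩ := h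
  obtain ⟨S, hS, hSm, hSv, hSw⟩ := h2 c' hc' hc2'
  have hn0 : (0 : ℝ) < n := by exact_mod_cast hn
  calc _ ≤ ENNReal.ofReal (β * M) * volume (Ico c (c + l / n)) :=
        withDensity_ofReal_le measurableSet_Ico fun x hx => (hfw x).trans <| by
          have := h1 x (Ico_subset_Ico hc hc2 hx)
          gcongr
    _ = ENNReal.ofReal (32 * n * (β / α)) *
          (ENNReal.ofReal (α * (M / (8 * n))) * ENNReal.ofReal (l / (4 * n))) := by
        rw [Real.volume_Ico, add_sub_cancel_left, ← ENNReal.ofReal_mul (by positivity),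
          ← ENNReal.ofReal_mul (by positivity), ← ENNReal.ofReal_mul (by positivity)]
        congr 1
        field_simp
        norm_num
    _ ≤ ENNReal.ofReal (32 * n * (β / α)) * (ENNReal.ofReal (α * (M / (8 * n))) * volume S) := by
        gcongr
    _ ≤ _ := by
        gcongr
        refine (le_withDensity_ofReal hSm fun x hx => le_trans ?_ (hwf x)).trans (measure_mono hS)
        have := hSw x hx
        gcongr

/-- The weight with dips at all places, multiplied by `i + 1` on `[1/2, 1)`. -/
noncomputable def density (p r : ℕ → ℝ) (i : ℕ) (x : ℝ) : ℝ :=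
  tailWeight p r 0 x * (1 + (Ico (1 / 2) 1).indicator (fun _ => (i : ℝ)) x)

/-- The measure with density `density p r i`. -/
noncomputable def dipMeasure (p r : ℕ → ℝ) (i : ℕ) : Measure ℝ :=
  volume.withDensity fun x => ENNReal.ofReal (density p r i x)

namespace IsPlaces

variable {p r : ℕ → ℝ} (h : IsPlaces p r)
include h

theorem tailWeight_le_density (i : ℕ) (x : ℝ) : tailWeight p r 0 x ≤ density p r i x := by
  refine le_mul_of_one_le_right (h.tailWeight_pos 0 x).le ?_
  have := indicator_nonneg (s := Ico (1 / 2 : ℝ) 1) (f := fun _ => (i : ℝ))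
    (fun _ _ => i.cast_nonneg) x
  linarith

theorem density_le (i : ℕ) (x : ℝ) : density p r i x ≤ (i + 1) * tailWeight p r 0 x := by
  rw [mul_comm]
  refine mul_le_mul_of_nonneg_left ?_ (h.tailWeight_pos 0 x).le
  have := indicator_le_self' (s := Ico (1 / 2 : ℝ) 1) (f := fun _ => (i : ℝ))
    (fun _ _ => i.cast_nonneg) x
  linarith

omit h in
theorem density_of_lt (i : ℕ) {x : ℝ} (hx : x < 1 / 2) :
    density p r i x = tailWeight p r 0 x := by
  rw [density, indicator_of_notMem (fun hx' => absurd hx'.1 (not_le.2 hx)), add_zero, mul_one]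

theorem density_of_mem (i : ℕ) {x : ℝ} (hx : x ∈ Ico (1 / 2 : ℝ) 1) :
    density p r i x = 1 + i := by
  rw [density, indicator_of_mem hx, h.tailWeight_of_ge 0 hx.1, one_mul]

omit h in
theorem measurable_density (i : ℕ) : Measurable (density p r i) :=
  (measurable_tailWeight 0).mul
    (measurable_const.add (measurable_const.indicator measurableSet_Ico))

theorem dipMeasure_le (i : ℕ) {s : Set ℝ} (hs : MeasurableSet s) :
    dipMeasure p r i s ≤ ENNReal.ofReal (i + 1) * volume s :=
  withDensity_ofReal_le hs fun x _ => (h.density_le i x).trans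
    (mul_le_of_le_one_right (by positivity) (h.tailWeight_le_one 0 x))

theorem isLocallyFiniteMeasure (i : ℕ) : IsLocallyFiniteMeasure (dipMeasure p r i) :=
  ⟨fun x => ⟨Ioo (x - 1) (x + 1), Ioo_mem_nhds (by linarith) (by linarith),
    (h.dipMeasure_le i measurableSet_Ioo).trans_lt <| by
      rw [Real.volume_Ioo]
      exact ENNReal.mul_lt_top ENNReal.ofReal_lt_top ENNReal.ofReal_lt_top⟩⟩

theorem volume_absolutelyContinuous (i : ℕ) : volume ≪ dipMeasure p r i :=
  withDensity_absolutelyContinuous' (measurable_density i).ennreal_ofReal.aemeasurable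
    (Filter.Eventually.of_forall fun x => by
      have := (h.tailWeight_pos 0 x).trans_le (h.tailWeight_le_density i x)
      simpa using this)

theorem isNadicDoubling (i : ℕ) {n : ℕ} (hn : 2 ≤ n) : IsNadicDoubling n (dipMeasure p r i) := by
  have hn0 : (0 : ℝ) < n := by exact_mod_cast (by omega : 0 < n)
  refine ⟨(32 * n * ((i + 1) / (((n : ℕ) : ℝ) + 2)⁻¹)).toNNReal, ?_, fun m K j hj j' hj' => ?_⟩
  · rw [Real.toNNReal_pos]
    positivity
  have hchild : ∀ j : ℕ, nadicChild n m K j =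
      Ico (((K - 1 : ℤ) : ℝ) / (n : ℝ) ^ m + ((j : ℝ) - 1) / (n : ℝ) ^ (m + 1))
        (((K - 1 : ℤ) : ℝ) / (n : ℝ) ^ m + ((j : ℝ) - 1) / (n : ℝ) ^ (m + 1)
          + 1 / (n : ℝ) ^ m / n) := fun j => by
    rw [nadicChild, zpow_add_one₀ hn0.ne']
    push_cast
    congr 1
    field_simp
    ring
  have hle : ∀ j ∈ Finset.Icc 1 n,
      ((K - 1 : ℤ) : ℝ) / (n : ℝ) ^ m ≤
        ((K - 1 : ℤ) : ℝ) / (n : ℝ) ^ m + ((j : ℝ) - 1) / (n : ℝ) ^ (m + 1) ∧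
      ((K - 1 : ℤ) : ℝ) / (n : ℝ) ^ m + ((j : ℝ) - 1) / (n : ℝ) ^ (m + 1) + 1 / (n : ℝ) ^ m / n ≤
        ((K - 1 : ℤ) : ℝ) / (n : ℝ) ^ m + 1 / (n : ℝ) ^ m := fun j hj => by
    rw [Finset.mem_Icc] at hj
    have h1 : (1 : ℝ) ≤ j := by exact_mod_cast hj.1
    have h2 : (j : ℝ) ≤ n := by exact_mod_cast hj.2
    constructor
    · have : 0 ≤ ((j : ℝ) - 1) / (n : ℝ) ^ (m + 1) := div_nonneg (by linarith) (by positivity)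
      linarith
    · have e : ((j : ℝ) - 1) / (n : ℝ) ^ (m + 1) + 1 / (n : ℝ) ^ m / n
          = 1 / (n : ℝ) ^ m * (j / n) := by
        rw [zpow_add_one₀ hn0.ne']
        field_simp
        ring
      have : 1 / (n : ℝ) ^ m * (j / n) ≤ 1 / (n : ℝ) ^ m :=
        mul_le_of_le_one_right (by positivity) ((div_le_one hn0).2 h2)
      linarith
  rw [hchild, hchild]
  -- Dropping the first `n` places leaves only those adapted to base `n`; this costs `n + 2`, and
  -- the change on `[1/2, 1)` costs `i + 1`.
  exact (h.isSpread_tailWeight hn (N := n) (by omega) m (K - 1)).withDensity_le (by omega)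
    (by positivity) (inv_add_two_pos n) (by positivity)
    (fun x => (h.le_tailWeight_zero n x).trans (h.tailWeight_le_density i x))
    (fun x => (h.density_le i x).trans (by
      have := h.tailWeight_zero_le n x
      gcongr))
    (hle j hj).1 (hle j hj).2 (hle j' hj').1 (hle j' hj').2

/-- With `h = v * r k`, the mass is at least `h / 4` on the left of `p k` and at most `2 * v * h` on
the right, which forces `k + 2 ≤ 8 * C`. -/
theorem not_isDoublingOn (i : ℕ) : ¬ IsDoublingOn (Ico 0 1) (dipMeasure p r i) := by
  rintro ⟨C, -, hC⟩
  obtain ⟨k, hk⟩ := exists_nat_gt (8 * (C : ℝ))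
  have hv0 := inv_add_two_pos k
  have hv1 := inv_add_two_le k
  have hv2 : ((k : ℝ) + 2)⁻¹ * (k + 2) = 1 := inv_mul_cancel₀ (by positivity)
  set v := ((k : ℝ) + 2)⁻¹ with hv
  have hr := h.radius_pos k
  have hrp := h.radius_le_div k
  have hp8 := h.centre_le k
  have hh : 0 < v * r k := by positivity
  have hhr : v * r k ≤ r k := by nlinarith
  have heq : ∀ x ∈ Ico (p k - v * r k) (p k + v * r k),
      density p r i x = dip (p k) (r k) v x := fun x hx => by
    rw [density_of_lt i (by linarith [hx.2])]
    -- `2 / 3 * p k` makes `[a, 2 * a]` contain a neighbourhood of `p k`.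
    exact h.tailWeight_eq_dipAt (N := 0) (a := 2 / 3 * p k)
      ⟨by linarith [hx.1], by linarith [hx.2]⟩ ⟨by linarith, by linarith⟩ (dipAt_centre k)
  have hL : ENNReal.ofReal (1 / 2 * (v * r k / 2)) ≤
      dipMeasure p r i (Ico (p k - v * r k) (p k - v * r k + v * r k)) := by
    calc _ = ENNReal.ofReal (1 / 2) * volume (Ico (p k - v * r k) (p k - v * r k / 2)) := by
          rw [Real.volume_Ico, ← ENNReal.ofReal_mul (by norm_num)]
          congr 1
          ring
      _ ≤ dipMeasure p r i (Ico (p k - v * r k) (p k - v * r k / 2)) :=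
          le_withDensity_ofReal measurableSet_Ico fun x hx => by
            rw [heq x ⟨hx.1, by linarith [hx.2]⟩]
            refine le_trans (le_min (by norm_num) ?_) (le_dip_left hr hv0)
            have : 1 / 2 ≤ (p k - x) / (v * r k) := by
              rw [le_div_iff₀ hh]
              linarith [hx.2]
            linarith
      _ ≤ _ := measure_mono (Ico_subset_Ico le_rfl (by linarith))
  have hR : dipMeasure p r i (Ico (p k - v * r k + v * r k) (p k - v * r k + 2 * (v * r k))) ≤
      ENNReal.ofReal (2 * v * (v * r k)) := by
    calc _ ≤ ENNReal.ofReal (2 * v) *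
          volume (Ico (p k - v * r k + v * r k) (p k - v * r k + 2 * (v * r k))) :=
          withDensity_ofReal_le measurableSet_Ico fun x hx => by
            rw [heq x ⟨by linarith [hx.1], by linarith [hx.2]⟩, dip,
              if_neg (by linarith [hx.1])]
            refine (min_le_right _ _).trans ?_
            have : (x - p k) / r k ≤ v := by
              rw [div_le_iff₀ hr]
              linarith [hx.2]
            linarith
      _ = _ := by
          rw [Real.volume_Ico, ← ENNReal.ofReal_mul (by positivity)]
          congr 1
          ring
  have := hL.trans ((hC (p k - v * r k) (v * r k) hh
    (Ico_subset_Ico (by linarith) (by linarith))).1.trans (mul_le_mul_right hR _))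
  rw [← ENNReal.ofReal_coe_nnreal, ← ENNReal.ofReal_mul (by positivity),
    ENNReal.ofReal_le_ofReal_iff (by positivity)] at this
  have h1 : (1 / 4 : ℝ) ≤ 2 * C * v := by
    refine le_of_mul_le_mul_right ?_ hh
    linarith
  nlinarith

/-- The mass of `[0, 1/2)` is independent of the index, positive and finite, so `c = 1`; the mass of
`[1/2, 1)` then determines the index. -/
theorem eq_of_smul_eq {i j : ℕ} {c : ℝ≥0}
    (h1 : dipMeasure p r i (Ico 0 (1 / 2)) = c • dipMeasure p r j (Ico 0 (1 / 2)))
    (h2 : dipMeasure p r i (Ico (1 / 2) 1) = c • dipMeasure p r j (Ico (1 / 2) 1)) : i = j := by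
  have hA : dipMeasure p r i (Ico 0 (1 / 2)) = dipMeasure p r j (Ico 0 (1 / 2)) := by
    rw [dipMeasure, dipMeasure, withDensity_apply _ measurableSet_Ico,
      withDensity_apply _ measurableSet_Ico]
    exact setLIntegral_congr_fun measurableSet_Ico fun x hx => by
      simp only [density_of_lt _ hx.2]
  have hA0 : dipMeasure p r j (Ico 0 (1 / 2)) ≠ 0 := fun h0 => by
    have := h.volume_absolutelyContinuous j h0
    simp at this
  have hAt : dipMeasure p r j (Ico 0 (1 / 2)) ≠ ⊤ := by
    refine ((h.dipMeasure_le j measurableSet_Ico).trans_lt ?_).ne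
    rw [Real.volume_Ico]
    exact ENNReal.mul_lt_top ENNReal.ofReal_lt_top ENNReal.ofReal_lt_top
  have hB : ∀ i, dipMeasure p r i (Ico (1 / 2) 1) = ENNReal.ofReal (1 + i) * volume (Ico (1 / 2 : ℝ) 1) :=
    fun i => by
    rw [dipMeasure, withDensity_apply _ measurableSet_Ico, ← setLIntegral_const]
    exact setLIntegral_congr_fun measurableSet_Ico fun x hx => by
      simp only [h.density_of_mem _ hx]
  have hc : (c : ENNReal) = 1 := by
    rw [hA, ENNReal.smul_def, smul_eq_mul] at h1
    exact (ENNReal.mul_left_inj hA0 hAt).1 (by rw [one_mul, ← h1])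
  rw [ENNReal.smul_def, hc, one_smul, hB, hB, Real.volume_Ico,
    ← ENNReal.ofReal_mul (by positivity), ← ENNReal.ofReal_mul (by positivity),
    ENNReal.ofReal_eq_ofReal_iff (by positivity) (by positivity)] at h2
  have : (i : ℝ) = j := by linarith
  exact_mod_cast this

end IsPlaces
-- Transfer to the torus
/-- The measure on the torus obtained from the restriction of `μ` to `[0, 1)`. -/
noncomputable def torusMeasure (μ : Measure ℝ) : Measure UnitAddCircle :=
  (μ.restrict (Ico 0 1)).map (fun x : ℝ => (x : UnitAddCircle))

theorem measurable_coe_unitAddCircle : Measurable (fun x : ℝ => (x : UnitAddCircle)) :=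
  AddCircle.measurable_mk'

theorem coe_eq_coe_iff_of_mem_Ico {x y : ℝ} (hx : x ∈ Ico (0 : ℝ) 1) (hy : y ∈ Ico (0 : ℝ) 1)
    (h : (x : UnitAddCircle) = y) : x = y :=
  (AddCircle.coe_eq_coe_iff_of_mem_Ico (p := (1 : ℝ)) (a := 0) (by simpa using hx)
    (by simpa using hy)).1 h

theorem measurableSet_toTorus {a b : ℝ} (ha : 0 ≤ a) (hb : b ≤ 1) :
    MeasurableSet (toTorus (Ico a b)) := by
  have hmeas := (AddCircle.measurableEquivIco (1 : ℝ) 0).measurable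
    (measurable_subtype_coe (measurableSet_Ico (a := a) (b := b)))
  convert hmeas using 1
  ext y
  obtain ⟨z, rfl⟩ := (AddCircle.measurableEquivIco (1 : ℝ) 0).symm.surjective y
  have hz : (z : ℝ) ∈ Ico (0 : ℝ) 1 := by simpa using z.2
  have hzc : (AddCircle.measurableEquivIco (1 : ℝ) 0).symm z = ((z : ℝ) : UnitAddCircle) := rfl
  simp only [mem_preimage, MeasurableEquiv.apply_symm_apply]
  rw [hzc]
  constructor
  · rintro ⟨x, hx, hxz⟩
    rwa [← coe_eq_coe_iff_of_mem_Ico ⟨ha.trans hx.1, hx.2.trans_le hb⟩ hz hxz]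
  · exact fun hz => ⟨z, hz, rfl⟩

theorem torusMeasure_toTorus (μ : Measure ℝ) {a b : ℝ} (ha : 0 ≤ a) (hb : b ≤ 1) :
    torusMeasure μ (toTorus (Ico a b)) = μ (Ico a b) := by
  rw [torusMeasure, Measure.map_apply measurable_coe_unitAddCircle (measurableSet_toTorus ha hb),
    Measure.restrict_apply (measurable_coe_unitAddCircle (measurableSet_toTorus ha hb))]
  congr 1
  ext x
  constructor
  · rintro ⟨⟨y, hy, hyx⟩, hx⟩
    rwa [← coe_eq_coe_iff_of_mem_Ico ⟨ha.trans hy.1, hy.2.trans_le hb⟩ hx hyx]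
  · exact fun hx => ⟨⟨x, hx, rfl⟩, ha.trans hx.1, hx.2.trans_le hb⟩

theorem isOpenPosMeasure_torusMeasure {μ : Measure ℝ} (h : volume ≪ μ) :
    (torusMeasure μ).IsOpenPosMeasure := by
  have h1 : (volume : Measure UnitAddCircle) ≪ torusMeasure μ := by
    rw [← (AddCircle.measurePreserving_mk (1 : ℝ) 0).map_eq, torusMeasure, zero_add,
      ← Measure.restrict_congr_set (Ico_ae_eq_Ioc (μ := (volume : Measure ℝ)))]
    exact (h.restrict _).map measurable_coe_unitAddCircle
  exact h1.isOpenPosMeasure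

theorem isDoublingOn_of_torusMeasure {μ : Measure ℝ}
    (h : IsTorusDoublingOn (Ico 0 1) (torusMeasure μ)) : IsDoublingOn (Ico 0 1) μ := by
  obtain ⟨C, hC, h⟩ := h
  refine ⟨C, hC, fun x l hl hx => ?_⟩
  obtain ⟨h0, h1⟩ := (Ico_subset_Ico_iff (by linarith)).1 hx
  have := h x l hl (by linarith) hx
  rwa [torusMeasure_toTorus μ h0 (by linarith), torusMeasure_toTorus μ (by linarith) h1] at this

theorem IsTorusDoubling.isTorusDoublingOn {μ : Measure UnitAddCircle} (h : IsTorusDoubling μ)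
    (D : Set ℝ) : IsTorusDoublingOn D μ := by
  obtain ⟨C, hC, h⟩ := h
  exact ⟨C, hC, fun x l hl hl2 _ => h x l hl hl2 (subset_univ _)⟩

theorem toTorus_Ico_add_int (a b : ℝ) (q : ℤ) :
    toTorus (Ico (a + q) (b + q)) = toTorus (Ico a b) := by
  have hq : ∀ x : ℝ, ((x + q : ℝ) : UnitAddCircle) = x := fun x => by
    have : ((q : ℝ) : UnitAddCircle) = 0 := (AddCircle.coe_eq_zero_iff 1).2 ⟨q, by simp⟩
    rw [AddCircle.coe_add, this, add_zero]
  rw [toTorus, toTorus, ← image_add_const_Ico, image_image]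
  simp only [hq]

theorem IsNadicDoubling.torusMeasure {μ : Measure ℝ} {n : ℕ} (hn : 2 ≤ n)
    (h : IsNadicDoubling n μ) : IsTorusNadicDoubling n (torusMeasure μ) := by
  obtain ⟨C, hC, h⟩ := h
  refine ⟨C, hC, fun m k => ?_⟩
  have hn0 : (0 : ℝ) < n := by exact_mod_cast (by omega : 0 < n)
  have hP : (0 : ℤ) < (n : ℤ) ^ m := by positivity
  have hP' : (0 : ℝ) < (n : ℝ) ^ m := by positivity
  -- Translation by the integer `q` moves the parent interval into `[0, 1)`, where torus and line
  -- masses agree.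
  set q := (k - 1) / (n : ℤ) ^ m with hq
  set t := (k - 1) % (n : ℤ) ^ m with ht
  have hkt : (k : ℝ) - 1 = t + (n : ℝ) ^ m * q := by
    have := Int.emod_add_mul_ediv (k - 1) ((n : ℤ) ^ m)
    rw [← hq, ← ht] at this
    exact_mod_cast this.symm
  have ht0 : (0 : ℝ) ≤ t := by exact_mod_cast Int.emod_nonneg _ hP.ne'
  have ht1 : (t : ℝ) + 1 ≤ (n : ℝ) ^ m := by exact_mod_cast Int.emod_lt_of_pos (k - 1) hP
  have key : ∀ j ∈ Finset.Icc 1 n,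
      _root_.torusMeasure μ (toTorus (nadicChild n m k j)) = μ (nadicChild n m (t + 1) j) := by
    intro j hj
    rw [Finset.mem_Icc] at hj
    have h1 : (1 : ℝ) ≤ j := by exact_mod_cast hj.1
    have h2 : (j : ℝ) ≤ n := by exact_mod_cast hj.2
    have e : nadicChild n m k j = Ico
        ((((t + 1 : ℤ) : ℝ) - 1) / (n : ℝ) ^ (m : ℤ) + ((j : ℝ) - 1) / (n : ℝ) ^ ((m : ℤ) + 1) + q)
        ((((t + 1 : ℤ) : ℝ) - 1) / (n : ℝ) ^ (m : ℤ) + (j : ℝ) / (n : ℝ) ^ ((m : ℤ) + 1) + q) := by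
      rw [nadicChild, hkt, zpow_natCast, add_div, mul_div_cancel_left₀ _ hP'.ne']
      push_cast
      congr 1 <;> ring
    rw [e, toTorus_Ico_add_int, torusMeasure_toTorus, nadicChild]
    · push_cast
      rw [add_sub_cancel_right]
      have : 0 ≤ ((j : ℝ) - 1) / (n : ℝ) ^ ((m : ℤ) + 1) := div_nonneg (by linarith) (by positivity)
      positivity
    · push_cast
      rw [add_sub_cancel_right, zpow_add_one₀ hn0.ne', zpow_natCast]
      have e2 : (t : ℝ) / (n : ℝ) ^ m + j / ((n : ℝ) ^ m * n) = (t + j / n) / (n : ℝ) ^ m := by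
        field_simp
      rw [e2, div_le_one hP']
      have := (div_le_one hn0).2 h2
      linarith
  intro i hi j hj
  rw [key i hi, key j hj]
  exact h m (t + 1) i hi j hj

theorem theorem1p1 :
    (∃ μ : ℕ → Measure ℝ,
      (∀ i j, i ≠ j → ∀ c : ℝ≥0, μ i ≠ c • μ j) ∧
      ∀ i, IsLocallyFiniteMeasure (μ i) ∧ (μ i).IsOpenPosMeasure ∧
        (∀ n : ℕ, 2 ≤ n → IsNadicDoubling n (μ i)) ∧
        ¬ IsDoubling (μ i) ∧ ¬ IsDoublingOn (Ico 0 1) (μ i)) ∧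
    (∃ μ : ℕ → Measure UnitAddCircle,
      (∀ i j, i ≠ j → ∀ c : ℝ≥0, μ i ≠ c • μ j) ∧
      ∀ i, IsFiniteMeasure (μ i) ∧ (μ i).IsOpenPosMeasure ∧
        (∀ n : ℕ, 2 ≤ n → IsTorusNadicDoubling n (μ i)) ∧
        ¬ IsTorusDoubling (μ i) ∧ ¬ IsTorusDoublingOn (Ico 0 1) (μ i)) := by
  obtain ⟨p, r, h1, h2, h3, h4, h5⟩ := exists_places
  have h : IsPlaces p r := ⟨h1, h2, h3, h4, h5⟩
  refine ⟨⟨dipMeasure p r, fun i j hij c hc => hij (h.eq_of_smul_eq (c := c) ?_ ?_), fun i =>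
    ⟨h.isLocallyFiniteMeasure i, (h.volume_absolutelyContinuous i).isOpenPosMeasure,
      fun n hn => h.isNadicDoubling i hn, fun ⟨C, hC, hd⟩ => h.not_isDoublingOn i
        ⟨C, hC, fun x l hl _ => hd x l hl (subset_univ _)⟩, h.not_isDoublingOn i⟩⟩,
    ⟨fun i => torusMeasure (dipMeasure p r i), fun i j hij c hc =>
      hij (h.eq_of_smul_eq (c := c) ?_ ?_), fun i =>
    ⟨⟨?_⟩, isOpenPosMeasure_torusMeasure (h.volume_absolutelyContinuous i),
      fun n hn => (h.isNadicDoubling i hn).torusMeasure hn,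
      fun hd => h.not_isDoublingOn i (isDoublingOn_of_torusMeasure (hd.isTorusDoublingOn _)),
      fun hd => h.not_isDoublingOn i (isDoublingOn_of_torusMeasure hd)⟩⟩⟩
  · rw [hc, Measure.smul_apply]
  · rw [hc, Measure.smul_apply]
  · beta_reduce at hc
    rw [← torusMeasure_toTorus (dipMeasure p r i) le_rfl (by norm_num), hc, Measure.smul_apply,
      torusMeasure_toTorus _ le_rfl (by norm_num)]
  · beta_reduce at hc
    rw [← torusMeasure_toTorus (dipMeasure p r i) (by norm_num) le_rfl, hc, Measure.smul_apply,
      torusMeasure_toTorus _ (by norm_num) le_rfl]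
  · beta_reduce
    rw [torusMeasure, Measure.map_apply measurable_coe_unitAddCircle MeasurableSet.univ,
      preimage_univ, Measure.restrict_apply_univ]
    refine (h.dipMeasure_le i measurableSet_Ico).trans_lt ?_
    rw [Real.volume_Ico]
    exact ENNReal.mul_lt_top ENNReal.ofReal_lt_top ENNReal.ofReal_lt_top
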